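/- Let $S$ be a set and let $\mathcal F$ be a family of finite subsets of $S$ such that $\emptyset\in\mathcal F$, $\{s\}\in\mathcal F$ for all $s\in S$, and $F\cup F'\in\mathcal F$ whenever $F,F'\in\mathcal F$ and $F\cap F'\neq\emptyset$. Call $C\subseteq S$ *connected* if for all $x,y\in C$ there is $F\in\mathcal F$ with $F\subseteq C$ and $x,y\in F$, and let $\mathcal C$ be the set of connected sets; the pair $(S,\mathcal C)$ is the *connectoid* induced by $\mathcal F$. The set of (non-empty) maximal connected subsets of $A\subseteq S$, its *components*, is denoted $\mathcal K(A)$; it is a partition of $A$. A *necklace* is a connected set $N=\bigcup_{n\in\mathbb N}H_n$, where the $H_n$ are finite connected sets with $H_i\cap H_j\neq\emptyset$ if and only if $|i-j|\le 1$. For every finite $X\subseteq S$ there is a unique component in $\mathcal K(N\setminus X)$ containing all but finitely many elements of $N$, the *$X$-tail* of $N$. Two necklaces are *equivalent* if for every finite $X\subseteq S$ their $X$-tails are contained in the same component in $\mathcal K(S\setminus X)$. The equivalence classes of necklaces are the *ends* of $(S,\mathcal C)$, and $\Omega(S,\mathcal C)$ is the set of ends. For a finite set $X\subseteq S$ and an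 end $\omega$, let $K(X,\omega)\in\mathcal K(S\setminus X)$ be the component containing the $X$-tails of all necklaces in $\omega$, and let $\Omega(X,\omega)=\{\psi\in\Omega(S,\mathcal C): K(X,\psi)=K(X,\omega)\}$. Let $|(S,\mathcal C)|$ be the topological space on the disjoint union $S\cup\Omega(S,\mathcal C)$ whose basic open sets are the singletons $\{s\}$ with $s\in S$ and the sets $K(X,\omega)\cup\Omega(X,\omega)$ with $X\subseteq S$ finite and $\omega\in\Omega(S,\mathcal C)$. Then, for every connectoid $(S,\mathcal C)$, the space $|(S,\mathcal C)|$ is compact (every open cover has a finite subcover) if and only if $(S,\mathcal C)$ is *solid*, that is, $\mathcal K(S\setminus X)$ is finite for every finite set $X\subseteq S$. -/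

import Mathlib

/-- A connectoid on the ground set `S`, given by its family `finConn` of finite connected sets. -/
structure Connectoid (S : Type*) where
  finConn : Set (Set S)
  finite_of_mem : ∀ F ∈ finConn, F.Finite
  union_mem : ∀ F ∈ finConn, ∀ F' ∈ finConn, (F ∩ F').Nonempty → F ∪ F' ∈ finConn
  singleton_mem : ∀ s : S, {s} ∈ finConn
  empty_mem : ∅ ∈ finConn

namespace Connectoid

variable {S : Type*} (C : Connectoid S)

/-- A set is connected if any two of its elements lie in a common finite connected subset. -/
def Connected (A : Set S) : Prop :=
  ∀ x ∈ A, ∀ y ∈ A, ∃ F ∈ C.finConn, F ⊆ A ∧ x ∈ F ∧ y ∈ F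

/-- The components of `A`: the maximal connected subsets of `A`. They are required to be non-empty
because they are the classes of a partition of `A`; this matters only for `A = ∅`, which has no
component. -/
def components (A : Set S) : Set (Set S) :=
  {K | K.Nonempty ∧ Maximal (fun B => C.Connected B ∧ B ⊆ A) K}

/-- `H` is a witness of `N`: a sequence of finite connected sets with union `N` in which exactly
the sets with equal or consecutive indices intersect. -/
def IsWitness (N : Set S) (H : ℕ → Set S) : Prop :=
  (∀ n, (H n).Finite ∧ C.Connected (H n)) ∧ (N = ⋃ n, H n) ∧
    ∀ i j, (H i ∩ H j).Nonempty ↔ i ≤ j + 1 ∧ j ≤ i + 1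

/-- A necklace is a connected set that has a witness. -/
def IsNecklace (N : Set S) : Prop :=
  C.Connected N ∧ ∃ H : ℕ → Set S, C.IsWitness N H

/-- The type of necklaces. -/
def Necklace : Type _ := {N : Set S // C.IsNecklace N}

variable {C}

theorem Connected.union {A B : Set S} (hA : C.Connected A) (hB : C.Connected B)
    (h : (A ∩ B).Nonempty) : C.Connected (A ∪ B) := by
  obtain ⟨z, hzA, hzB⟩ := h
  have key : ∀ x ∈ A ∪ B, ∃ F ∈ C.finConn, F ⊆ A ∪ B ∧ x ∈ F ∧ z ∈ F := by
    rintro x (hx | hx)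
    · obtain ⟨F, hF, hs, h1, h2⟩ := hA x hx z hzA
      exact ⟨F, hF, hs.trans Set.subset_union_left, h1, h2⟩
    · obtain ⟨F, hF, hs, h1, h2⟩ := hB x hx z hzB
      exact ⟨F, hF, hs.trans Set.subset_union_right, h1, h2⟩
  intro x hx y hy
  obtain ⟨F, hF, hs, h1, h2⟩ := key x hx
  obtain ⟨F', hF', hs', h1', h2'⟩ := key y hy
  exact ⟨F ∪ F', C.union_mem F hF F' hF' ⟨z, h2, h2'⟩, Set.union_subset hs hs', Or.inl h1,
    Or.inr h1'⟩

theorem components_eq {A K K' : Set S} (hK : K ∈ C.components A) (hK' : K' ∈ C.components A)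
    (h : (K ∩ K').Nonempty) : K = K' := by
  have hu : C.Connected (K ∪ K') ∧ K ∪ K' ⊆ A :=
    ⟨hK.2.prop.1.union hK'.2.prop.1 h, Set.union_subset hK.2.prop.2 hK'.2.prop.2⟩
  have h1 := hK.2.eq_of_subset hu Set.subset_union_left
  have h2 := hK'.2.eq_of_subset hu Set.subset_union_right
  exact h1.trans h2.symm

theorem exists_component {A B : Set S} (hB : C.Connected B) (hBA : B ⊆ A) (hne : B.Nonempty) :
    ∃ K ∈ C.components A, B ⊆ K := by
  obtain ⟨b, hb⟩ := hne
  let K : Set S := {y | ∃ D, C.Connected D ∧ D ⊆ A ∧ b ∈ D ∧ y ∈ D}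
  have hmem : ∀ D, C.Connected D → D ⊆ A → b ∈ D → D ⊆ K :=
    fun D h1 h2 h3 y hy => ⟨D, h1, h2, h3, hy⟩
  refine ⟨K, ⟨⟨b, B, hB, hBA, hb, hb⟩, ⟨?_, ?_⟩, ?_⟩, hmem B hB hBA hb⟩
  · rintro x ⟨D, h1, h2, h3, h4⟩ y ⟨D', h1', h2', h3', h4'⟩
    have hu := h1.union h1' ⟨b, h3, h3'⟩
    obtain ⟨F, hF, hs, hx, hy⟩ := hu x (Or.inl h4) y (Or.inr h4')
    exact ⟨F, hF, hs.trans (hmem _ hu (Set.union_subset h2 h2') (Or.inl h3)), hx, hy⟩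
  · rintro x ⟨D, -, h2, -, h4⟩
    exact h2 h4
  · intro D hD hKD
    exact hmem D hD.1 hD.2 (hKD ⟨B, hB, hBA, hb, hb⟩)

theorem IsWitness.infinite {N : Set S} {H : ℕ → Set S} (h : C.IsWitness N H) : N.Infinite := by
  obtain ⟨-, rfl, hint⟩ := h
  have hne : ∀ n, (H n).Nonempty := fun n => by
    simpa using (hint n n).2 ⟨by omega, by omega⟩
  choose f hf using hne
  refine Set.infinite_of_injective_forall_mem (f := fun n => f (2 * n)) ?_
    (fun n => Set.mem_iUnion.2 ⟨_, hf (2 * n)⟩)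
  intro i j hij
  have := (hint (2 * i) (2 * j)).1 ⟨f (2 * i), hf _, by
    have hij' : f (2 * i) = f (2 * j) := hij
    rw [hij']; exact hf _⟩
  omega

theorem IsWitness.exists_avoid {N : Set S} {H : ℕ → Set S} (h : C.IsWitness N H) (X : Finset S) :
    ∃ m, ∀ n, m ≤ n → Disjoint (H n) (X : Set S) := by
  classical
  induction X using Finset.induction_on with
  | empty => exact ⟨0, by simp⟩
  | insert a X _ ih =>
    obtain ⟨m, hm⟩ := ih
    have ha : ∃ k, ∀ n, k ≤ n → a ∉ H n := by
      by_cases hex : ∃ k, a ∈ H k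
      · obtain ⟨k, hk⟩ := hex
        refine ⟨k + 2, fun n hn han => ?_⟩
        have := (h.2.2 n k).1 ⟨a, han, hk⟩
        omega
      · exact ⟨0, fun n _ hn => hex ⟨n, hn⟩⟩
    obtain ⟨k, hk⟩ := ha
    refine ⟨max m k, fun n hn => ?_⟩
    rw [Finset.coe_insert, Set.disjoint_insert_right]
    exact ⟨hk n (le_trans (le_max_right _ _) hn), hm n (le_trans (le_max_left _ _) hn)⟩

theorem IsWitness.connected_tail {N : Set S} {H : ℕ → Set S} (h : C.IsWitness N H) (m : ℕ) :
    C.Connected (⋃ n, H (m + n)) := by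
  have hpart : ∀ k, C.Connected (⋃ n, ⋃ (_ : n ≤ k), H (m + n)) := by
    intro k
    induction k with
    | zero => simpa using (h.1 m).2
    | succ k ih =>
      have heq : (⋃ n, ⋃ (_ : n ≤ k + 1), H (m + n)) =
          (⋃ n, ⋃ (_ : n ≤ k), H (m + n)) ∪ H (m + (k + 1)) := by
        ext x
        simp only [Set.mem_iUnion, Set.mem_union, exists_prop]
        constructor
        · rintro ⟨n, hn, hx⟩
          rcases Nat.lt_or_ge k n with h' | h'
          · obtain rfl : n = k + 1 := by omega
            exact Or.inr hx
          · exact Or.inl ⟨n, h', hx⟩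
        · rintro (⟨n, hn, hx⟩ | hx)
          · exact ⟨n, by omega, hx⟩
          · exact ⟨k + 1, le_rfl, hx⟩
      rw [heq]
      refine ih.union (h.1 _).2 ?_
      obtain ⟨z, hz, hz'⟩ := (h.2.2 (m + k) (m + (k + 1))).2 ⟨by omega, by omega⟩
      exact ⟨z, by simp only [Set.mem_iUnion]; exact ⟨k, le_rfl, hz⟩, hz'⟩
  intro x hx y hy
  obtain ⟨i, hi⟩ := Set.mem_iUnion.1 hx
  obtain ⟨j, hj⟩ := Set.mem_iUnion.1 hy
  obtain ⟨F, hF, hs, h1, h2⟩ := hpart (max i j) x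
    (by simp only [Set.mem_iUnion]; exact ⟨i, le_max_left _ _, hi⟩) y
    (by simp only [Set.mem_iUnion]; exact ⟨j, le_max_right _ _, hj⟩)
  refine ⟨F, hF, hs.trans ?_, h1, h2⟩
  exact Set.iUnion_mono fun n => Set.iUnion_subset fun _ => subset_rfl

/-- For every finite `X`, exactly one component of `N \ X` contains almost all elements of the
necklace `N`. -/
theorem Necklace.existsUnique_tail (N : C.Necklace) (X : Finset S) :
    ∃! T : Set S, T ∈ C.components (N.1 \ X) ∧ (N.1 \ T).Finite := by
  obtain ⟨N, hN, H, hH⟩ := N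
  obtain ⟨m, hm⟩ := hH.exists_avoid X
  have hsub : (⋃ n, H (m + n)) ⊆ N \ (X : Set S) := by
    refine Set.iUnion_subset fun n => ?_
    rw [Set.subset_sdiff]
    refine ⟨?_, hm _ (by omega)⟩
    rw [hH.2.1]
    exact Set.subset_iUnion H (m + n)
  obtain ⟨z, hz, -⟩ := (hH.2.2 (m + 0) (m + 0)).2 ⟨by omega, by omega⟩
  obtain ⟨T, hT, hsT⟩ := exists_component (hH.connected_tail m) hsub
    ⟨z, Set.mem_iUnion.2 ⟨0, hz⟩⟩
  have hfin : (N \ T).Finite := by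
    refine ((Set.finite_Iio m).biUnion (t := H) fun n _ => (hH.1 n).1).subset ?_
    rintro x ⟨hx, hxT⟩
    rw [hH.2.1] at hx
    obtain ⟨n, hn⟩ := Set.mem_iUnion.1 hx
    simp only [Set.mem_iUnion]
    refine ⟨n, ?_, hn⟩
    by_contra hlt
    have hle : m ≤ n := by simpa using hlt
    refine hxT (hsT (Set.mem_iUnion.2 ⟨n - m, ?_⟩))
    rwa [Nat.add_sub_cancel' hle]
  refine ⟨T, ⟨hT, hfin⟩, ?_⟩
  rintro T' ⟨hT', hfin'⟩
  refine components_eq hT' hT ?_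
  by_contra hdisj
  refine hH.infinite ((hfin.union hfin').subset fun x hx => ?_)
  by_cases hxT : x ∈ T
  · exact Or.inr ⟨hx, fun hxT' => hdisj ⟨x, hxT', hxT⟩⟩
  · exact Or.inl ⟨hx, hxT⟩

/-- The `X`-tail of a necklace `N`: the component of `N \ X` containing almost all of `N`. -/
noncomputable def Necklace.tail (N : C.Necklace) (X : Finset S) : Set S :=
  (N.existsUnique_tail X).choose

theorem Necklace.tail_spec (N : C.Necklace) (X : Finset S) :
    N.tail X ∈ C.components (N.1 \ X) ∧ (N.1 \ N.tail X).Finite :=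
  (N.existsUnique_tail X).choose_spec.1

/-- Two necklaces are equivalent if, for every finite `X`, their `X`-tails lie in the same component
of `S \ X`. -/
def Necklace.Equivalent (N N' : C.Necklace) : Prop :=
  ∀ X : Finset S, ∃ K ∈ C.components (X : Set S)ᶜ, N.tail X ⊆ K ∧ N'.tail X ⊆ K

theorem Necklace.exists_component_tail (N : C.Necklace) (X : Finset S) :
    ∃ K ∈ C.components (X : Set S)ᶜ, N.tail X ⊆ K := by
  have h := (N.tail_spec X).1
  exact exists_component h.2.prop.1 (fun x hx => (h.2.prop.2 hx).2) h.1

theorem Necklace.component_tail_unique (N : C.Necklace) (X : Finset S) {K K' : Set S}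
    (hK : K ∈ C.components (X : Set S)ᶜ) (hK' : K' ∈ C.components (X : Set S)ᶜ)
    (h : N.tail X ⊆ K) (h' : N.tail X ⊆ K') : K = K' := by
  obtain ⟨z, hz⟩ := (N.tail_spec X).1.1
  exact components_eq hK hK' ⟨z, h hz, h' hz⟩

variable (C)

/-- Equivalence of necklaces is an equivalence relation. -/
instance necklaceSetoid : Setoid C.Necklace where
  r := Necklace.Equivalent
  iseqv :=
    { refl := fun N X => by
        obtain ⟨K, hK, h⟩ := N.exists_component_tail X
        exact ⟨K, hK, h, h⟩
      symm := fun h X => by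
        obtain ⟨K, hK, h1, h2⟩ := h X
        exact ⟨K, hK, h2, h1⟩
      trans := fun {_ N _} h h' X => by
        obtain ⟨K, hK, h1, h2⟩ := h X
        obtain ⟨K', hK', h1', h2'⟩ := h' X
        obtain rfl := N.component_tail_unique X hK hK' h2 h1'
        exact ⟨K, hK, h1, h2'⟩ }

/-- The ends of a connectoid: the equivalence classes of its necklaces. -/
def End : Type _ := Quotient C.necklaceSetoid

variable {C}

/-- The end containing the necklace `N`. -/
def Necklace.toEnd (N : C.Necklace) : C.End := Quotient.mk C.necklaceSetoid N

theorem End.existsUnique_comp (X : Finset S) (ω : C.End) :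
    ∃! K : Set S, K ∈ C.components (X : Set S)ᶜ ∧
      ∀ N : C.Necklace, N.toEnd = ω → N.tail X ⊆ K := by
  induction ω using Quotient.inductionOn with
  | h N =>
    obtain ⟨K, hK, h⟩ := N.exists_component_tail X
    refine ⟨K, ⟨hK, fun N' hN' => ?_⟩, ?_⟩
    · obtain ⟨K', hK', h1, h2⟩ := (Quotient.exact hN' : N'.Equivalent N) X
      obtain rfl := N.component_tail_unique X hK hK' h h2
      exact h1
    · rintro K' ⟨hK', h'⟩
      exact N.component_tail_unique X hK' hK (h' N rfl) h

/-- `K(X, ω)`: the component of `S \ X` containing the `X`-tails of all necklaces in `ω`. -/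
noncomputable def End.comp (X : Finset S) (ω : C.End) : Set S :=
  (End.existsUnique_comp X ω).choose

theorem End.comp_spec (X : Finset S) (ω : C.End) :
    End.comp X ω ∈ C.components (X : Set S)ᶜ ∧
      ∀ N : C.Necklace, N.toEnd = ω → N.tail X ⊆ End.comp X ω :=
  (End.existsUnique_comp X ω).choose_spec.1

/-- `Ω(X, ω)`: the set of all ends `ψ` with `K(X, ψ) = K(X, ω)`. -/
def End.cone (X : Finset S) (ω : C.End) : Set C.End := {ψ | End.comp X ψ = End.comp X ω}

variable (C)

/-- The underlying set of `|(S, 𝒞)|`: the disjoint union of `S` and the set of ends. -/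
def Space : Type _ := S ⊕ C.End

variable {C}

/-- An element of the ground set as a point of `|(S, 𝒞)|`. -/
def Space.ofPoint (s : S) : C.Space := Sum.inl s

/-- An end as a point of `|(S, 𝒞)|`. -/
def Space.ofEnd (ω : C.End) : C.Space := Sum.inr ω

/-- The basic open set `K(X, ω) ∪ Ω(X, ω)` of `|(S, 𝒞)|`. -/
def Space.basicNhd (X : Finset S) (ω : C.End) : Set C.Space :=
  Space.ofPoint '' End.comp X ω ∪ Space.ofEnd '' End.cone X ω

/-- The topology of `|(S, 𝒞)|`, generated by the singletons `{s}` with `s ∈ S` and the sets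
`K(X, ω) ∪ Ω(X, ω)` with `X ⊆ S` finite and `ω` an end. -/
instance Space.instTopologicalSpace : TopologicalSpace C.Space :=
  TopologicalSpace.generateFrom
    ({U | ∃ s : S, U = {Space.ofPoint s}} ∪
      {U | ∃ (X : Finset S) (ω : C.End), U = Space.basicNhd X ω})

variable (C)

/-- A connectoid is solid if `S \ X` has only finitely many components for every finite `X`. -/
def Solid : Prop := ∀ X : Finset S, (C.components (X : Set S)ᶜ).Finite

end Connectoid

/-! If the space is compact, cover it by the points of `X` and one region per component of `S \ X`.
Each point of `S` lies in exactly one member of this cover, so no component can be dropped.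

Conversely, let `U` be an ultrafilter containing no `{s}` with `s` in `S`. Solidity makes the same
cover finite, so for each `X` some component `f X` has its region in `U`. Regions in `U` intersect,
hence `f` is a direction; once `f` comes from an end, `U` converges to that end.

The core is therefore `IsDirection.exists_end`, which splits on the sets dominating `f`. If
dominating sets exist away from every finite set, infinitely many disjoint ones are strung into a
necklace. Otherwise some finite `D` meets them all; then every finite set avoiding `D` can be
separated from `f`, and iterating this yields a decreasing sequence `f (Y n)` with empty
intersection, along which a necklace is built. -/

theorem exists_seq_of_forall_exists {σ : Type*} {good : σ → Prop} {r : σ → σ → Prop} {a : σ}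
    (ha : good a) (step : ∀ b, good b → ∃ c, good c ∧ r b c) :
    ∃ u : ℕ → σ, (∀ n, good (u n)) ∧ ∀ n, r (u n) (u (n + 1)) := by
  choose! g hg hr using step
  have hgood : ∀ n, good (g^[n] a) := fun n => by
    induction n with
    | zero => exact ha
    | succ n ih => rw [Function.iterate_succ_apply']; exact hg _ ih
  refine ⟨fun n => g^[n] a, hgood, fun n => ?_⟩
  simp only [Function.iterate_succ_apply']
  exact hr _ (hgood n)

namespace Connectoid

variable {S : Type*} {C : Connectoid S}

/-! ### Finite connected sets and necklaces -/

theorem connected_of_mem_finConn {F : Set S} (hF : F ∈ C.finConn) : C.Connected F :=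
  fun _ hx _ hy => ⟨F, hF, subset_rfl, hx, hy⟩

theorem subset_component {A K B : Set S} (hK : K ∈ C.components A) (hB : C.Connected B)
    (hBA : B ⊆ A) (h : (B ∩ K).Nonempty) : B ⊆ K := by
  obtain ⟨z, hzB, hzK⟩ := h
  obtain ⟨K', hK', hBK'⟩ := exists_component hB hBA ⟨z, hzB⟩
  rwa [components_eq hK hK' ⟨z, hzK, hBK' hzB⟩]

theorem Connected.exists_finset_superset {A : Set S} (hA : C.Connected A) (hne : A.Nonempty)
    (P : Finset S) (hP : ↑P ⊆ A) :
    ∃ F : Finset S, ↑F ∈ C.finConn ∧ ↑F ⊆ A ∧ P ⊆ F := by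
  classical
  obtain ⟨a, ha⟩ := hne
  suffices ∃ F : Set S, F ∈ C.finConn ∧ F ⊆ A ∧ ↑P ⊆ F ∧ a ∈ F by
    obtain ⟨F, hF, hFA, hPF, -⟩ := this
    refine ⟨(C.finite_of_mem F hF).toFinset, by simpa, by simpa, fun x hx => by simpa using hPF hx⟩
  induction P using Finset.induction_on with
  | empty => exact ⟨{a}, C.singleton_mem a, by simpa, by simp, rfl⟩
  | insert b P _ ih =>
    rw [Finset.coe_insert, Set.insert_subset_iff] at hP
    obtain ⟨F, hF, hFA, hPF, haF⟩ := ih hP.2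
    obtain ⟨F', hF', hFA', haF', hbF'⟩ := hA a ha b hP.1
    refine ⟨F ∪ F', C.union_mem F hF F' hF' ⟨a, haF, haF'⟩, Set.union_subset hFA hFA', ?_,
      Or.inl haF⟩
    rw [Finset.coe_insert, Set.insert_subset_iff]
    exact ⟨Or.inr hbF', hPF.trans Set.subset_union_left⟩

theorem IsWitness.isNecklace {N : Set S} {H : ℕ → Set S} (h : C.IsWitness N H) :
    C.IsNecklace N := by
  refine ⟨?_, H, h⟩
  rw [h.2.1]
  simpa using h.connected_tail 0

theorem isWitness_of_disjoint {H : ℕ → Finset S} (hH : ∀ n, ↑(H n) ∈ C.finConn)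
    (hne : ∀ n, ((H n : Set S) ∩ H (n + 1)).Nonempty)
    (hdisj : ∀ i j, i + 2 ≤ j → Disjoint (H i) (H j)) :
    C.IsWitness (⋃ n, (H n : Set S)) (fun n => H n) := by
  refine ⟨fun n => ⟨(H n).finite_toSet, connected_of_mem_finConn (hH n)⟩, rfl, fun i j => ?_⟩
  constructor
  · rintro ⟨z, hzi, hzj⟩
    constructor <;> by_contra hlt
    · exact Finset.disjoint_left.1 (hdisj j i (by omega)) hzj hzi
    · exact Finset.disjoint_left.1 (hdisj i j (by omega)) hzi hzj
  · rintro ⟨h1, h2⟩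
    obtain rfl | rfl | rfl : j = i ∨ j = i + 1 ∨ i = j + 1 := by omega
    · obtain ⟨z, hz, -⟩ := hne j
      exact ⟨z, hz, hz⟩
    · exact hne i
    · exact (Set.inter_comm _ _).subst (hne j)

/-- Only finitely many elements of the necklace lie outside the tail, and late sets of the witness
avoid them. -/
theorem IsWitness.exists_subset_tail {N : C.Necklace} {H : ℕ → Set S} (h : C.IsWitness N.1 H)
    (X : Finset S) : ∃ m, ∀ n, m ≤ n → H n ⊆ N.tail X := by
  obtain ⟨m, hm⟩ := h.exists_avoid (N.tail_spec X).2.toFinset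
  refine ⟨m, fun n hn x hx => ?_⟩
  by_contra hxT
  refine Set.disjoint_left.1 (hm n hn) hx ?_
  simp only [Set.Finite.coe_toFinset]
  exact ⟨h.2.1 ▸ Set.mem_iUnion.2 ⟨n, hx⟩, hxT⟩

/-! ### Directions and the ends that induce them -/

/-- A direction chooses consistently a component of the complement of every finite set. -/
structure IsDirection (C : Connectoid S) (f : Finset S → Set S) : Prop where
  mem : ∀ X : Finset S, f X ∈ C.components (X : Set S)ᶜ
  anti : ∀ X Y : Finset S, X ⊆ Y → f Y ⊆ f X

namespace IsDirection

variable {f : Finset S → Set S}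

theorem nonempty (hf : C.IsDirection f) (X : Finset S) : (f X).Nonempty := (hf.mem X).1

theorem connected (hf : C.IsDirection f) (X : Finset S) : C.Connected (f X) := (hf.mem X).2.prop.1

theorem notMem (hf : C.IsDirection f) {X : Finset S} {x : S} (hx : x ∈ f X) : x ∉ X :=
  (hf.mem X).2.prop.2 hx

/-- Both `f X` and `f Y` contain the non-empty set `f (X ∪ Y)`, so the connected set `f Y` meets the
component `f X`. -/
theorem subset_of_disjoint (hf : C.IsDirection f) {X Y : Finset S}
    (h : Disjoint (f Y) (X : Set S)) : f Y ⊆ f X := by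
  classical
  obtain ⟨z, hz⟩ := hf.nonempty (X ∪ Y)
  exact subset_component (hf.mem X) (hf.connected Y) (Set.disjoint_left.1 h)
    ⟨z, hf.anti _ _ Finset.subset_union_right hz, hf.anti _ _ Finset.subset_union_left hz⟩

/-- Late sets of the witness lie in the `X`-tail, so the component of the new end meets `f X` and
equals it. -/
theorem exists_end_of_isWitness (hf : C.IsDirection f) {N : Set S} {H : ℕ → Set S}
    (hH : C.IsWitness N H) (hfH : ∀ X m, ∃ n, m ≤ n ∧ (H n ∩ f X).Nonempty) :
    ∃ ω : C.End, ∀ X, End.comp X ω = f X := by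
  let N' : C.Necklace := ⟨N, hH.isNecklace⟩
  refine ⟨N'.toEnd, fun X => ?_⟩
  obtain ⟨m, hm⟩ := IsWitness.exists_subset_tail (N := N') hH X
  obtain ⟨n, hn, z, hzH, hzf⟩ := hfH X m
  exact components_eq (End.comp_spec X _).1 (hf.mem X)
    ⟨z, (End.comp_spec X _).2 N' rfl (hm n hn hzH), hzf⟩

/-- A direction with a countable base is induced by an end. -/
theorem exists_end_of_iInter_eq_empty (hf : C.IsDirection f) {Y : ℕ → Finset S} (hY : Monotone Y)
    (hempty : ⋂ n, f (Y n) = ∅) : ∃ ω : C.End, ∀ X, End.comp X ω = f X := by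
  classical
  have hfY : Antitone fun n => f (Y n) := fun i j hij => hf.anti _ _ (hY hij)
  have avoid : ∀ F : Finset S, ∃ k, ∀ c, k ≤ c → Disjoint (f (Y c)) (F : Set S) := by
    intro F
    have hx : ∀ x, ∃ k, x ∉ f (Y k) := fun x => by
      have : x ∉ ⋂ n, f (Y n) := by simp [hempty]
      simpa using this
    choose k hk using hx
    refine ⟨F.sup k, fun c hc => Set.disjoint_left.2 fun x hxc hxF => ?_⟩
    exact hk x (hfY ((Finset.le_sup hxF).trans hc) hxc)
  obtain ⟨x₀, hx₀⟩ := hf.nonempty (Y 0)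
  -- In a state `(a, b, F)`, the set `F` lies in `f (Y a)` and reaches into `f (Y b)`. Its successor
  -- starts at a point of `F` in `f (Y b)` and stays there; the new second index is so large that
  -- all sets after the successor miss `F`.
  obtain ⟨u, hgood, hr⟩ := exists_seq_of_forall_exists (σ := ℕ × ℕ × Finset S)
    (good := fun s => (s.2.2 : Set S) ∈ C.finConn ∧ (s.2.2 : Set S) ⊆ f (Y s.1) ∧
      ((s.2.2 : Set S) ∩ f (Y s.2.1)).Nonempty)
    (r := fun s t => t.1 = s.2.1 ∧ s.2.1 < t.2.1 ∧ ((s.2.2 : Set S) ∩ t.2.2).Nonempty ∧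
      Disjoint (f (Y t.2.1)) (s.2.2 : Set S))
    (a := (0, 0, {x₀})) ⟨by simpa using C.singleton_mem x₀, by simpa, x₀, by simpa⟩ (by
      rintro ⟨a, b, F⟩ ⟨-, -, x, hxF, hxb⟩
      obtain ⟨k, hk⟩ := avoid F
      obtain ⟨y, hy⟩ := hf.nonempty (Y (max k (b + 1)))
      have hyb : y ∈ f (Y b) := hfY (show b ≤ max k (b + 1) by omega) hy
      obtain ⟨F', hF', hsub, hmem⟩ := (hf.connected (Y b)).exists_finset_superset ⟨x, hxb⟩ {x, y}
        (by simp [Set.insert_subset_iff, hxb, hyb])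
      exact ⟨(b, max k (b + 1), F'), ⟨hF', hsub, y, hmem (by simp), hy⟩, rfl,
        show b < max k (b + 1) by omega, ⟨x, hxF, hmem (by simp)⟩, hk _ (le_max_left _ _)⟩)
  have hb : ∀ n, n ≤ (u n).2.1 := fun n => by
    induction n with
    | zero => exact Nat.zero_le _
    | succ n ih => have := (hr n).2.1; omega
  -- The shift avoids the initial state, as `good` does not record that the first index is at most
  -- the second.
  have hmono : Monotone fun n => (u (n + 1)).1 := monotone_nat_of_le_succ fun n => by
    have h1 := (hr n).1
    have h2 := (hr n).2.1
    have h3 := (hr (n + 1)).1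
    omega
  refine hf.exists_end_of_isWitness (isWitness_of_disjoint (H := fun n => (u n).2.2)
    (fun n => (hgood n).1) (fun n => (hr n).2.2.1) fun i j hij => ?_) fun X m => ?_
  · obtain ⟨j, rfl⟩ := Nat.exists_eq_add_of_le' (show 1 ≤ j by omega)
    rw [← Finset.disjoint_coe]
    refine ((hr i).2.2.2.mono_left ((hgood (j + 1)).2.1.trans (hfY ?_))).symm
    rw [← (hr (i + 1)).1]
    exact hmono (show i + 1 ≤ j by omega)
  · obtain ⟨k, hk⟩ := avoid X
    refine ⟨max m k + 1, by omega, ?_⟩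
    obtain ⟨z, hz⟩ : ((u (max m k + 1)).2.2 : Set S).Nonempty := (hgood _).2.2.left
    refine ⟨z, hz, hf.subset_of_disjoint (hk _ ?_) ((hgood _).2.1 hz)⟩
    have h1 := (hr (max m k)).1
    have h2 := hb (max m k)
    omega

/-! ### Dominating sets -/

/-- A non-empty finite set dominates a direction `f` if it lies in `f X` whenever it avoids `X`. -/
def Dominates (f : Finset S → Set S) (P : Finset S) : Prop :=
  P.Nonempty ∧ ∀ X, Disjoint X P → (P : Set S) ⊆ f X

/-- A minimal subset of `P` with the property `hP` dominates: if `X` violates domination, then `P ∩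
f X` is smaller and still has the property. -/
theorem exists_dominates_subset (hf : C.IsDirection f) {P : Finset S}
    (hP : ∀ Z, Disjoint Z P → ((P : Set S) ∩ f Z).Nonempty) : ∃ Q ⊆ P, Dominates f Q := by
  classical
  induction P using Finset.strongInduction with
  | H P ih =>
    by_cases hdom : Dominates f P
    · exact ⟨P, subset_rfl, hdom⟩
    have hne : P.Nonempty := by
      obtain ⟨z, hz, -⟩ := hP ∅ (by simp)
      exact ⟨z, hz⟩
    obtain ⟨X, hXP, hX⟩ : ∃ X, Disjoint X P ∧ ¬ (P : Set S) ⊆ f X := by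
      by_contra! h
      exact hdom ⟨hne, h⟩
    have hss : P.filter (· ∈ f X) ⊂ P := by
      rw [Finset.filter_ssubset]
      simpa [Set.subset_def] using hX
    obtain ⟨Q, hQ, hdomQ⟩ := ih _ hss fun Z hZ => by
      -- Deleting `X` along with `Z \ P` confines the component to `f X`, where `Z` has no element
      -- of `P`; so it misses all of `Z`.
      obtain ⟨z, hzP, hz⟩ := hP ((Z \ P) ∪ X)
        (Finset.disjoint_union_left.2 ⟨Finset.sdiff_disjoint, hXP⟩)
      have hsub := hf.anti X _ (Finset.subset_union_right (s₁ := Z \ P))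
      refine ⟨z, by simpa using ⟨hzP, hsub hz⟩, hf.subset_of_disjoint ?_ hz⟩
      refine Set.disjoint_left.2 fun y hy hyZ => ?_
      by_cases hyP : y ∈ P
      · exact Finset.disjoint_left.1 hZ hyZ (by simpa using ⟨hyP, hsub hy⟩)
      · exact hf.notMem hy (by
          rw [Finset.mem_union, Finset.mem_sdiff]
          exact Or.inl ⟨hyZ, hyP⟩)
    exact ⟨Q, hQ.trans (Finset.filter_subset _ _), hdomQ⟩

/-- A direction that has infinitely many disjoint dominating sets is induced by an end. -/
theorem exists_end_of_dominates (hf : C.IsDirection f)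
    (hdom : ∀ D : Finset S, ∃ P, Dominates f P ∧ Disjoint D P) :
    ∃ ω : C.End, ∀ X, End.comp X ω = f X := by
  classical
  obtain ⟨P₀, hP₀, -⟩ := hdom ∅
  -- In a state `(W, P)`, `W` collects the elements to be avoided. The set `F` links `P` to `P'`
  -- inside `f W`; `P'` stays out of the new `W` because the next link must contain it, and enters
  -- one step later.
  obtain ⟨u, hgood, hr⟩ := exists_seq_of_forall_exists (σ := Finset S × Finset S)
    (good := fun s => Dominates f s.2 ∧ Disjoint s.1 s.2)
    (r := fun s t => Disjoint s.2 t.2 ∧ ∃ F : Finset S, (F : Set S) ∈ C.finConn ∧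
      (F : Set S) ⊆ f s.1 ∧ s.2 ⊆ F ∧ t.2 ⊆ F ∧ t.1 = s.1 ∪ (F \ t.2))
    (a := (∅, P₀)) ⟨hP₀, by simp⟩ (by
      rintro ⟨W, P⟩ ⟨hP, hWP⟩
      obtain ⟨P', hP', hd⟩ := hdom (W ∪ P)
      rw [Finset.disjoint_union_left] at hd
      obtain ⟨F, hF, hFW, hPF⟩ := (hf.connected W).exists_finset_superset (hf.nonempty W) (P ∪ P')
        (by
          rw [Finset.coe_union]
          exact Set.union_subset (hP.2 W hWP) (hP'.2 W hd.1))
      exact ⟨(W ∪ (F \ P'), P'),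
        ⟨hP', Finset.disjoint_union_left.2 ⟨hd.1, Finset.sdiff_disjoint⟩⟩, hd.2, F, hF, hFW,
        Finset.subset_union_left.trans hPF, Finset.subset_union_right.trans hPF, rfl⟩)
  choose hPP F hF hFW hPF hPF' hW using hr
  have hWmono : Monotone fun n => (u n).1 := monotone_nat_of_le_succ fun n => by
    rw [hW n]
    exact Finset.subset_union_left
  have hFW2 : ∀ n, F n ⊆ (u (n + 2)).1 := fun n x hx => by
    rw [hW (n + 1), hW n]
    by_cases hxP : x ∈ (u (n + 1)).2
    · exact Finset.mem_union_right _ (Finset.mem_sdiff.2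
        ⟨hPF _ hxP, Finset.disjoint_left.1 (hPP (n + 1)) hxP⟩)
    · exact Finset.mem_union_left _ (Finset.mem_union_right _ (Finset.mem_sdiff.2 ⟨hx, hxP⟩))
  have hwit := isWitness_of_disjoint (H := F) hF
    (fun n => by
      obtain ⟨z, hz⟩ := (hgood (n + 1)).1.1
      exact ⟨z, hPF' n hz, hPF (n + 1) hz⟩)
    fun i j hij => Finset.disjoint_left.2 fun x hxi hxj =>
      hf.notMem (hFW j hxj) (hWmono hij (hFW2 i hxi))
  refine hf.exists_end_of_isWitness hwit fun X m => ?_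
  obtain ⟨k, hk⟩ := hwit.exists_avoid X
  refine ⟨max m k, le_max_left _ _, ?_⟩
  obtain ⟨z, hz⟩ := (hgood (max m k)).1.1
  refine ⟨z, hPF _ hz, (hgood _).1.2 X ?_ hz⟩
  exact Finset.disjoint_left.2 fun x hxX hxP =>
    Set.disjoint_left.1 (hk _ (le_max_right _ _)) (hPF _ hxP) hxX

/-- If all dominating sets meet a fixed finite set, then the direction has a countable base. -/
theorem exists_monotone_iInter_eq_empty (hf : C.IsDirection f) {D : Finset S}
    (hD : ∀ P, Dominates f P → ¬ Disjoint D P) :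
    ∃ Y : ℕ → Finset S, Monotone Y ∧ ⋂ n, f (Y n) = ∅ := by
  classical
  have hsep : ∀ P, Disjoint D P → ∃ Z, Disjoint Z P ∧ Disjoint (P : Set S) (f Z) := by
    intro P hP
    by_contra! h
    obtain ⟨Q, hQP, hQ⟩ := hf.exists_dominates_subset (P := P) fun Z hZ => by
      exact Set.not_disjoint_iff_nonempty_inter.1 (h Z hZ)
    exact hD Q hQ (hP.mono_right hQP)
  -- Each `Z` cuts `f Z` off from the current `P`, which then absorbs `Z \ D`. Hence `p` lies
  -- outside every `f Z`, and the sets `Z \ D` are pairwise disjoint.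
  obtain ⟨p, hp⟩ := hf.nonempty D
  obtain ⟨u, hgood, hr⟩ := exists_seq_of_forall_exists (σ := Finset S × Finset S)
    (good := fun s => p ∈ s.1 ∧ Disjoint D s.1)
    (r := fun s t => Disjoint t.2 s.1 ∧ Disjoint (s.1 : Set S) (f t.2) ∧
      t.1 = s.1 ∪ (t.2 \ D))
    (a := ({p}, ∅)) ⟨by simp, by simpa using hf.notMem hp⟩ (by
      rintro ⟨P, X⟩ ⟨hpP, hDP⟩
      obtain ⟨Z, hZP, hPZ⟩ := hsep P hDP
      exact ⟨(P ∪ (Z \ D), Z), ⟨Finset.mem_union_left _ hpP,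
        Finset.disjoint_union_right.2 ⟨hDP, Finset.disjoint_sdiff⟩⟩, hZP, hPZ, rfl⟩)
  have hmono : Monotone fun n => (u n).1 := monotone_nat_of_le_succ fun n => by
    rw [(hr n).2.2]
    exact Finset.subset_union_left
  refine ⟨fun n => D ∪ partialSups (fun n => (u (n + 1)).2) n,
    fun i j hij => Finset.union_subset_union_right ((partialSups _).monotone hij), ?_⟩
  rw [Set.eq_empty_iff_forall_notMem]
  intro s hs
  rw [Set.mem_iInter] at hs
  have hsD : s ∈ f D := hf.anti _ _ Finset.subset_union_left (hs 0)
  have hsX : ∀ n, s ∈ f (u (n + 1)).2 := fun n =>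
    hf.anti _ _ ((le_partialSups _ n).trans Finset.subset_union_right) (hs n)
  -- A finite connected set joining `s` to `p` outside `D` would have to meet all of these
  -- infinitely many disjoint sets.
  obtain ⟨F, hF, hFD, hsF, hpF⟩ := hf.connected D s hsD p hp
  have hmeet : ∀ n, ∃ x ∈ F, x ∈ (u (n + 1)).2 := fun n => by
    by_contra! h
    have hsub := subset_component (hf.mem (u (n + 1)).2) (connected_of_mem_finConn hF) h
      ⟨s, hsF, hsX n⟩
    exact Set.disjoint_left.1 (hr n).2.1 (hgood n).1 (hsub hpF)
  choose g hgF hg using hmeet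
  refine Set.infinite_of_injective_forall_mem (.of_lt_imp_ne fun i j hij hgij => ?_) hgF
    (C.finite_of_mem F hF)
  refine Finset.disjoint_left.1 (hr j).1 (hg j) (hmono (show i + 1 ≤ j from hij) ?_)
  simp only [(hr i).2.2, ← hgij]
  exact Finset.mem_union_right _ (Finset.mem_sdiff.2 ⟨hg i, hf.notMem (hFD (hgF i))⟩)

/-- Every direction is induced by an end. -/
theorem exists_end (hf : C.IsDirection f) : ∃ ω : C.End, ∀ X, End.comp X ω = f X := by
  by_cases h : ∀ D : Finset S, ∃ P, Dominates f P ∧ Disjoint D P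
  · exact hf.exists_end_of_dominates h
  · push Not at h
    obtain ⟨D, hD⟩ := h
    obtain ⟨Y, hY, hempty⟩ := hf.exists_monotone_iInter_eq_empty hD
    exact hf.exists_end_of_iInter_eq_empty hY hempty

end IsDirection

/-- Late sets of a witness lie in both the `X`-tail and the `Y`-tail, so the two components meet. -/
theorem End.comp_anti (ω : C.End) {X Y : Finset S} (h : X ⊆ Y) : End.comp Y ω ⊆ End.comp X ω := by
  induction ω using Quotient.inductionOn with
  | h N =>
    obtain ⟨-, H, hH⟩ := N.2
    obtain ⟨m, hm⟩ := hH.exists_subset_tail X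
    obtain ⟨k, hk⟩ := hH.exists_subset_tail Y
    obtain ⟨z, hz, -⟩ := (hH.2.2 (max m k) (max m k)).2 ⟨by omega, by omega⟩
    have hX := End.comp_spec X (Necklace.toEnd N)
    have hY := End.comp_spec Y (Necklace.toEnd N)
    exact subset_component hX.1 hY.1.2.prop.1
      (hY.1.2.prop.2.trans (Set.compl_subset_compl.2 (Finset.coe_subset.2 h)))
      ⟨z, hY.2 N rfl (hk _ (le_max_right _ _) hz), hX.2 N rfl (hm _ (le_max_left _ _) hz)⟩

/-! ### Regions and compactness -/

namespace Space

/-- The points of `K` together with all ends that live in `K` after deleting `X`. -/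
def region (X : Finset S) (K : Set S) : Set C.Space :=
  ofPoint '' K ∪ ofEnd '' {ω : C.End | End.comp X ω = K}

theorem ofPoint_mem_region {X : Finset S} {K : Set S} {s : S} :
    (ofPoint s : C.Space) ∈ region X K ↔ s ∈ K := by
  constructor
  · rintro (⟨t, ht, h⟩ | ⟨ω, -, h⟩)
    · exact Sum.inl_injective h ▸ ht
    · exact absurd h Sum.inr_ne_inl
  · exact fun h => Or.inl ⟨s, h, rfl⟩

theorem ofEnd_mem_region {X : Finset S} {K : Set S} {ω : C.End} :
    ofEnd ω ∈ region X K ↔ End.comp X ω = K := by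
  constructor
  · rintro (⟨t, -, h⟩ | ⟨ψ, hψ, h⟩)
    · exact absurd h Sum.inl_ne_inr
    · exact Sum.inr_injective h ▸ hψ
  · exact fun h => Or.inr ⟨ω, h, rfl⟩

theorem isOpen_singleton_ofPoint (s : S) : IsOpen {(ofPoint s : C.Space)} :=
  .basic _ (Or.inl ⟨s, rfl⟩)

/-- If no end lives in `K`, the region is not a basic open set of an end, but it consists of
isolated points only. -/
theorem isOpen_region (X : Finset S) (K : Set S) : IsOpen (region X K : Set C.Space) := by
  by_cases h : ∃ ω : C.End, End.comp X ω = K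
  · obtain ⟨ω, rfl⟩ := h
    exact .basic _ (Or.inr ⟨X, ω, rfl⟩)
  · have hempty : {ω : C.End | End.comp X ω = K} = ∅ :=
      Set.eq_empty_iff_forall_notMem.2 fun ω hω => h ⟨ω, hω⟩
    rw [region, hempty, Set.image_empty, Set.union_empty, ← Set.biUnion_of_singleton (ofPoint '' K),
      Set.biUnion_image]
    exact isOpen_biUnion fun s _ => isOpen_singleton_ofPoint s

theorem exists_mem_region (X : Finset S) (z : C.Space) :
    (∃ x ∈ X, z = ofPoint x) ∨ ∃ K ∈ C.components (X : Set S)ᶜ, z ∈ region X K := by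
  obtain s | ω := z
  · by_cases hs : s ∈ X
    · exact Or.inl ⟨s, hs, rfl⟩
    · obtain ⟨K, hK, hsK⟩ := exists_component (A := (X : Set S)ᶜ)
        (connected_of_mem_finConn (C.singleton_mem s)) (by simpa using hs) (Set.singleton_nonempty s)
      exact Or.inr ⟨K, hK, ofPoint_mem_region.2 (hsK rfl)⟩
  · exact Or.inr ⟨_, (End.comp_spec X ω).1, ofEnd_mem_region.2 rfl⟩

end Space

theorem solid_of_compactSpace [CompactSpace C.Space] : C.Solid := by
  classical
  intro X
  obtain ⟨t, ht⟩ := isCompact_univ.elim_finite_subcover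
    (fun i : X ⊕ C.components (X : Set S)ᶜ =>
      i.elim (fun x => {(Space.ofPoint x.1 : C.Space)}) fun K => Space.region X K.1)
    (by
      rintro (x | K)
      · exact Space.isOpen_singleton_ofPoint x.1
      · exact Space.isOpen_region X K.1)
    (by
      intro z _
      rw [Set.mem_iUnion]
      obtain ⟨x, hx, rfl⟩ | ⟨K, hK, hz⟩ := Space.exists_mem_region X z
      · exact ⟨Sum.inl ⟨x, hx⟩, rfl⟩
      · exact ⟨Sum.inr ⟨K, hK⟩, hz⟩)
  -- A point of `K` is covered only by the region of `K`.
  have hall : ∀ K : C.components (X : Set S)ᶜ, Sum.inr K ∈ t := by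
    intro K
    obtain ⟨s, hs⟩ := K.2.1
    obtain ⟨i, hi, hsi⟩ := Set.mem_iUnion₂.1 (ht (Set.mem_univ (Space.ofPoint s : C.Space)))
    obtain x | K' := i
    · obtain rfl : s = x.1 := Sum.inl_injective hsi
      exact absurd x.2 (K.2.2.prop.2 hs)
    · have hs' : s ∈ K'.1 := Space.ofPoint_mem_region.1 hsi
      obtain rfl : K = K' := Subtype.ext (components_eq K.2 K'.2 ⟨s, hs, hs'⟩)
      exact hi
  exact Set.finite_coe_iff.1 (Finite.of_injective (fun K => (⟨Sum.inr K, hall K⟩ : t))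
    fun K K' h => Sum.inr_injective (congrArg Subtype.val h))

theorem Solid.exists_region_mem (hC : C.Solid) (U : Ultrafilter C.Space)
    (hU : ∀ s : S, {(Space.ofPoint s : C.Space)} ∉ U) (X : Finset S) :
    ∃ K ∈ C.components (X : Set S)ᶜ, Space.region X K ∈ U := by
  have huniv : (⋃ x ∈ (X : Set S), {(Space.ofPoint x : C.Space)}) ∪
      ⋃ K ∈ C.components (X : Set S)ᶜ, Space.region X K ∈ U := by
    refine Filter.mem_of_superset Filter.univ_mem fun z _ => ?_
    obtain ⟨x, hx, rfl⟩ | ⟨K, hK, hz⟩ := Space.exists_mem_region X z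
    · exact Or.inl (Set.mem_biUnion (x := x) hx rfl)
    · exact Or.inr (Set.mem_biUnion hK hz)
  rw [Ultrafilter.union_mem_iff, Ultrafilter.finite_biUnion_mem_iff X.finite_toSet,
    Ultrafilter.finite_biUnion_mem_iff (hC X)] at huniv
  obtain ⟨x, -, hx⟩ | h := huniv
  · exact absurd hx (hU x)
  · exact h

theorem Solid.compactSpace (hC : C.Solid) : CompactSpace C.Space := by
  rw [← isCompact_univ_iff, isCompact_iff_ultrafilter_le_nhds]
  intro U _
  by_cases hU : ∀ s : S, {(Space.ofPoint s : C.Space)} ∉ U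
  · choose f hf hfU using hC.exists_region_mem U hU
    have hdir : C.IsDirection f := ⟨hf, fun X Y hXY => by
      obtain ⟨z, hzX, hzY⟩ := U.nonempty_of_mem (Filter.inter_mem (hfU X) (hfU Y))
      obtain s | ω := z
      · exact subset_component (hf X) (hf Y).2.prop.1
          ((hf Y).2.prop.2.trans (Set.compl_subset_compl.2 (Finset.coe_subset.2 hXY)))
          ⟨s, Space.ofPoint_mem_region.1 hzY, Space.ofPoint_mem_region.1 hzX⟩
      · rw [← Space.ofEnd_mem_region.1 hzX, ← Space.ofEnd_mem_region.1 hzY]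
        exact ω.comp_anti hXY⟩
    obtain ⟨ω, hω⟩ := hdir.exists_end
    refine ⟨Space.ofEnd ω, Set.mem_univ _, ?_⟩
    rw [TopologicalSpace.nhds_generateFrom]
    refine le_iInf₂ fun V hV => Filter.le_principal_iff.2 ?_
    obtain ⟨hωV, ⟨s, rfl⟩ | ⟨X, ψ, rfl⟩⟩ := hV
    -- A singleton of a point of `S` contains no end, so only the sets `K(X, ψ) ∪ Ω(X, ψ)` matter.
    · exact absurd hωV Sum.inr_ne_inl
    · have : End.comp X ω = End.comp X ψ := Space.ofEnd_mem_region.1 hωV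
      have hmem := hfU X
      rw [← hω X, this] at hmem
      exact hmem
  · push Not at hU
    obtain ⟨s, hs⟩ := hU
    refine ⟨Space.ofPoint s, Set.mem_univ _, fun V hV => ?_⟩
    exact Filter.mem_of_superset hs (Set.singleton_subset_iff.2 (mem_of_mem_nhds hV))

end Connectoid

theorem mainTheorem9 {S : Type*} (C : Connectoid S) : CompactSpace C.Space ↔ C.Solid :=
  ⟨fun _ => Connectoid.solid_of_compactSpace, Connectoid.Solid.compactSpace⟩
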